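/- Let $\Gamma$ be the monoid of monomials $z^\gamma$ in countably many variables $z_1,z_2,\dots$, either commuting (multi-indices) or noncommuting (words), with $z^\alpha z^\beta=z^{\alpha+\beta}$ (concatenation in the noncommuting case). Let $\mathcal H$ be a committee space: a complex Hilbert space of formal power series $h=\sum_\gamma h_\gamma z^\gamma$ with continuous coefficient functionals, containing the polynomials as a dense subspace, in which distinct monomials are orthogonal and $\|z^{\alpha+\beta}\|\le\|z^\alpha\|\,\|z^\beta\|$ for all $\alpha,\beta$; assume the normalization $\|1\|=1$. For a multiplier $f$ (a power series with $f\mathcal H\subseteq\mathcal H$ and bounded multiplication) let $M_f h=fh$. Let $v=(v_\gamma)_{\gamma\in\Gamma}$ be a random multiplier model: complex random variables with $E(v_\gamma)=0$, $E(|v_\gamma|^2)<\infty$, $E(\overline{v_\gamma}v_{\gamma'})=0$ for $\gamma\ne\gamma'$, and such that for some constant $C>0$, almost surely, $f_v=\sum_\gamma v_\gamma z^\gamma$ is a multiplier with $\|M_{f_v}\|\le C$. Put $$R_v=E(M_{f_v}M_{f_v}^*),\qquad C_v=E(M_{f_v}^*M_{f_v}),$$ with expectations of operators taken in the weak sense.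 The natural domain of $\mathrm{Mult}\,\mathcal H$ is the set of tuples $x=(x_1,x_2,\dots)$ of complex $N\times N$ matrices ($N\ge1$ arbitrary) such that $M_{z_i}\mapsto x_i$ defines a completely contractive unital homomorphism on the algebra of polynomials in the $M_{z_i}$, and such that $h(x)=\sum_\gamma h_\gamma x^\gamma$ converges unconditionally for every $h\in\mathcal H$. A random point is a random variable $x$ with values in the natural domain such that $P(h(x)=0)<1$ for every nonzero $h\in\mathcal H$. Let $x^{(1)},x^{(2)},\dots$ be independent identically distributed random points, let $X_n=(x^{(1)},\dots,x^{(n)})$, let $P_{X_n}$ be the orthogonal projection of $\mathcal H$ onto $\{h: h(x^{(k)})=0 \text{ for } 1\le k\le n\}^\perp$, and put $$R_v^{X_n}=E_v(P_{X_n}M_{f_v}P_{X_n}M_{f_v}^*P_{X_n}),\qquad C_v^{X_n}=E_v(P_{X_n}M_{f_v}^*P_{X_n}M_{f_v}P_{X_n}),$$ where the expectation is over $v$ only, with $X_n$ held fixed. Then $R_v$ and $C_v$ exist, and almost surely (with respect to the points) all $R_v^{X_n}$, $C_v^{X_n}$ exist and $$\|R_v\|=\lim_{n\to\infty}\|R_v^{X_n}\|\le\lim_{n\to\infty}\|C_v^{X_n}\|=\|C_v\|.$$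 -/

import Mathlib

open MeasureTheory ProbabilityTheory Filter Topology
open scoped InnerProductSpace

noncomputable section

/-- `Γ` is the monoid of monomials in the variables `z i`, `i : ι` (with `gen i` the variable
`z i`): words in noncommuting variables, or multi-indices in commuting variables. The product of
`Γ` is the product of monomials, `z^α z^β = z^(α * β)`. -/
def IsMonomialMonoid {ι Γ : Type*} [Monoid Γ] (gen : ι → Γ) : Prop :=
  (∃ e : FreeMonoid ι ≃* Γ, ∀ i, e (FreeMonoid.of i) = gen i) ∨
  (∃ e : Multiplicative (ι →₀ ℕ) ≃* Γ,
    ∀ i, e (Multiplicative.ofAdd (Finsupp.single i 1)) = gen i)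

/-- A structure of Hilbert space of formal power series `∑ c_γ z^γ` on the Hilbert space `H`:
each element is determined by its coefficients, which depend continuously on it, all monomials
belong to the space, and the polynomials are dense. -/
structure PowerSeriesSpace (Γ H : Type*) [NormedAddCommGroup H] [InnerProductSpace ℂ H] where
  /-- the coefficients of an element -/
  coeff : H →ₗ[ℂ] (Γ → ℂ)
  coeff_injective : Function.Injective coeff
  continuous_coeff : ∀ γ, Continuous fun h => coeff h γ
  /-- the monomial `z^γ` -/
  monomial : Γ → H
  coeff_monomial_self : ∀ γ, coeff (monomial γ) γ = 1
  coeff_monomial_ne : ∀ γ δ, δ ≠ γ → coeff (monomial γ) δ = 0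
  dense_polynomials : Dense (Submodule.span ℂ (Set.range monomial) : Set H)

/-- Committee space: the monomials are orthogonal and satisfy the committee inequality. -/
structure IsCommitteeSpace {Γ H : Type*} [Monoid Γ] [NormedAddCommGroup H]
    [InnerProductSpace ℂ H] (S : PowerSeriesSpace Γ H) : Prop where
  orthogonal : ∀ α β, α ≠ β → ⟪S.monomial α, S.monomial β⟫_ℂ = 0
  committee : ∀ α β, ‖S.monomial (α * β)‖ ≤ ‖S.monomial α‖ * ‖S.monomial β‖

/-- The product of formal power series. (A monomial has only finitely many factorizations.) -/
def seriesMul {Γ : Type*} [Monoid Γ] (f g : Γ → ℂ) (γ : Γ) : ℂ :=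
  ∑ᶠ (p : Γ × Γ) (_ : p.1 * p.2 = γ), f p.1 * g p.2

section Multipliers

variable {Γ H : Type*} [Monoid Γ] [NormedAddCommGroup H] [InnerProductSpace ℂ H]

/-- `T` is the operator `h ↦ f h` of (left) multiplication by the formal power series `f`. -/
def IsMulOp (S : PowerSeriesSpace Γ H) (f : Γ → ℂ) (T : H →L[ℂ] H) : Prop :=
  ∀ h, S.coeff (T h) = seriesMul f (S.coeff h)

/-- The formal power series `f` is a multiplier. -/
def IsMultiplier (S : PowerSeriesSpace Γ H) (f : Γ → ℂ) : Prop :=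
  ∃ T : H →L[ℂ] H, IsMulOp S f T

open Classical in
/-- The multiplication operator `M_f` (only meaningful if `f` is a multiplier). -/
def mulOp (S : PowerSeriesSpace Γ H) (f : Γ → ℂ) : H →L[ℂ] H :=
  if h : IsMultiplier S f then h.choose else 0

end Multipliers

section Expectation

variable {Ω H : Type*} [MeasurableSpace Ω] [NormedAddCommGroup H] [InnerProductSpace ℂ H]

/-- `R` is the expectation, in the weak sense, of the random operator `T`. -/
def HasOperatorExpectation (P : Measure Ω) (T : Ω → H →L[ℂ] H) (R : H →L[ℂ] H) : Prop :=
  ∀ g h : H, Integrable (fun ω => ⟪g, T ω h⟫_ℂ) P ∧ ∫ ω, ⟪g, T ω h⟫_ℂ ∂P = ⟪g, R h⟫_ℂ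

open Classical in
/-- The expectation `E(T)` of a random operator, in the weak sense (`0` if there is none). -/
def operatorExpectation (P : Measure Ω) (T : Ω → H →L[ℂ] H) : H →L[ℂ] H :=
  if h : ∃ R, HasOperatorExpectation P T R then h.choose else 0

end Expectation

/-- Random multiplier model; `f_v = ∑ v_γ z^γ` has the coefficients `fun γ => v γ ω`. -/
structure IsRandomMultiplierModel {Γ H Ω : Type*} [Monoid Γ] [NormedAddCommGroup H]
    [InnerProductSpace ℂ H] [MeasurableSpace Ω] (S : PowerSeriesSpace Γ H) (P : Measure Ω)
    (v : Γ → Ω → ℂ) : Prop where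
  memLp : ∀ γ, MemLp (v γ) 2 P
  mean_zero : ∀ γ, ∫ ω, v γ ω ∂P = 0
  uncorrelated : ∀ γ γ', γ ≠ γ' → ∫ ω, (starRingEnd ℂ) (v γ ω) * v γ' ω ∂P = 0
  bounded : ∃ C : ℝ, 0 < C ∧ ∀ᵐ ω ∂P,
    IsMultiplier S (fun γ => v γ ω) ∧ ‖mulOp S (fun γ => v γ ω)‖ ≤ C

/-- Tuples `(x i)` of complex square matrices of a common finite size; each size gives one
(measurable) component. -/
abbrev MatrixTuple (ι : Type*) : Type _ := Σ N : ℕ, ι → Fin N → Fin N → ℂ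

/-- The `i`-th matrix of a tuple. -/
def MatrixTuple.mat {ι : Type*} (x : MatrixTuple ι) (i : ι) : Matrix (Fin x.1) (Fin x.1) ℂ :=
  Matrix.of (x.2 i)

section Points

variable {ι Γ H : Type*} [Monoid Γ] [NormedAddCommGroup H] [InnerProductSpace ℂ H]

/-- `φ` is the evaluation of monomials at the tuple `x`, `γ ↦ x^γ`. -/
def IsMonomialEval (gen : ι → Γ) (x : MatrixTuple ι)
    (φ : Γ →* Matrix (Fin x.1) (Fin x.1) ℂ) : Prop :=
  ∀ i, φ (gen i) = x.mat i

open Classical in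
/-- The matrix `x^γ` (only meaningful if `x` satisfies the relations of the variables, that is,
in the case of commuting variables, if the matrices commute). -/
def evalMonomial (gen : ι → Γ) (x : MatrixTuple ι) (γ : Γ) : Matrix (Fin x.1) (Fin x.1) ℂ :=
  if h : ∃ φ, IsMonomialEval gen x φ then h.choose γ else 0

/-- The value `p(x)` of a polynomial. -/
def evalPolynomial (gen : ι → Γ) (x : MatrixTuple ι) (p : Γ →₀ ℂ) :
    Matrix (Fin x.1) (Fin x.1) ℂ :=
  p.sum fun γ c => c • evalMonomial gen x γ

/-- The value `h(x) = ∑ h_γ x^γ` of an element of the power series space. -/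
def evalSeries (S : PowerSeriesSpace Γ H) (gen : ι → Γ) (x : MatrixTuple ι) (h : H) :
    Matrix (Fin x.1) (Fin x.1) ℂ :=
  ∑' γ, S.coeff h γ • evalMonomial gen x γ

/-- The operator on the Hilbert space `E^m` given by an `m × m` matrix of operators on `E`. -/
def blockOp {E : Type*} [NormedAddCommGroup E] [InnerProductSpace ℂ E] {m : ℕ}
    (T : Fin m → Fin m → E →L[ℂ] E) :
    PiLp 2 (fun _ : Fin m => E) →L[ℂ] PiLp 2 (fun _ : Fin m => E) :=
  (PiLp.continuousLinearEquiv 2 ℂ (fun _ : Fin m => E)).symm.toContinuousLinearMap ∘L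
    ContinuousLinearMap.pi fun i => ∑ j, T i j ∘L PiLp.proj 2 (fun _ : Fin m => E) j

/-- The natural domain of the multiplier algebra: the tuples `x` of matrices such that
`M_{z i} ↦ x i` is a completely contractive homomorphism, at which the elements of the space can
be evaluated. -/
structure InNaturalDomain (S : PowerSeriesSpace Γ H) (gen : ι → Γ) (x : MatrixTuple ι) :
    Prop where
  size_pos : 0 < x.1
  homomorphism : ∃ φ, IsMonomialEval gen x φ
  completely_contractive : ∀ (m : ℕ) (p : Fin m → Fin m → Γ →₀ ℂ),
    ‖blockOp fun i j => Matrix.toEuclideanCLM (𝕜 := ℂ) (evalPolynomial gen x (p i j))‖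
      ≤ ‖blockOp fun i j => mulOp S (p i j)‖
  summable : ∀ h : H, Summable fun γ => S.coeff h γ • evalMonomial gen x γ

/-- Random point: a random variable in the natural domain such that `P(h(x) = 0) < 1` for every
nonzero `h`. -/
structure IsRandomPoint {Ω : Type*} [MeasurableSpace Ω] (S : PowerSeriesSpace Γ H)
    (gen : ι → Γ) (P : Measure Ω) (x : Ω → MatrixTuple ι) : Prop where
  aemeasurable : AEMeasurable x P
  inNaturalDomain : ∀ᵐ ω ∂P, InNaturalDomain S gen (x ω)
  prob_lt_one : ∀ h : H, h ≠ 0 → P {ω | evalSeries S gen (x ω) h = 0} < 1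

variable [CompleteSpace H]

/-- The projection `P_X` onto `{h | h(x^(k)) = 0 for all k}ᗮ`, for `X = (x^(0), …, x^(n-1))`. -/
def nodeProj (S : PowerSeriesSpace Γ H) (gen : ι → Γ) {n : ℕ} (X : Fin n → MatrixTuple ι) :
    H →L[ℂ] H :=
  (Submodule.span ℂ {h : H | ∀ k, evalSeries S gen (X k) h = 0})ᗮ.starProjection

end Points

section RowColumn

variable {Γ H Ω : Type*} [Monoid Γ] [NormedAddCommGroup H] [InnerProductSpace ℂ H]
  [CompleteSpace H]

/-- `M_f M_f^*` for the random multiplier `f = f_v`, compressed by `Q`: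
`Q M_f Q M_f^* Q`. -/
def rowTerm (S : PowerSeriesSpace Γ H) (v : Γ → Ω → ℂ) (Q : H →L[ℂ] H) (ω : Ω) : H →L[ℂ] H :=
  Q ∘L mulOp S (fun γ => v γ ω) ∘L Q ∘L
    ContinuousLinearMap.adjoint (mulOp S fun γ => v γ ω) ∘L Q

/-- `M_f^* M_f` for the random multiplier `f = f_v`, compressed by `Q`:
`Q M_f^* Q M_f Q`. -/
def colTerm (S : PowerSeriesSpace Γ H) (v : Γ → Ω → ℂ) (Q : H →L[ℂ] H) (ω : Ω) : H →L[ℂ] H :=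
  Q ∘L ContinuousLinearMap.adjoint (mulOp S fun γ => v γ ω) ∘L Q ∘L
    mulOp S (fun γ => v γ ω) ∘L Q

variable [MeasurableSpace Ω]

/-- `E(Q M_f Q M_f^* Q)`: this is `R_v` for `Q = 1` and `R_v^X` for `Q = P_X`. -/
def rowOp (S : PowerSeriesSpace Γ H) (P : Measure Ω) (v : Γ → Ω → ℂ) (Q : H →L[ℂ] H) :
    H →L[ℂ] H :=
  operatorExpectation P (rowTerm S v Q)

/-- `E(Q M_f^* Q M_f Q)`: this is `C_v` for `Q = 1` and `C_v^X` for `Q = P_X`. -/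
def colOp (S : PowerSeriesSpace Γ H) (P : Measure Ω) (v : Γ → Ω → ℂ) (Q : H →L[ℂ] H) :
    H →L[ℂ] H :=
  operatorExpectation P (colTerm S v Q)

end RowColumn

end

/-! Row-column inequality. In the monomial basis `R_v` is diagonal: an entry between `z^α` and `z^β`
sums over factorizations of `α` and of `β`. Orthogonality of monomials kills all pairs except those
with equal right factors, and uncorrelatedness all except those with equal left factors. The
normalized diagonal entry at `α` is the sum of `E|v_γ|² ‖z^α‖²/‖z^δ‖²` over `γ * δ = α`. By the
committee inequality and left cancellation it is at most `∑ E|v_γ|² ‖z^γ‖²`, and every finite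
partial sum of this is at most `⟨1, C_v 1⟩ ≤ ‖C_v‖` (`sum_norm_sq_le_norm_colOp`,
`norm_rowOp_le_norm_colOp`).

Limits. Each term has the form `A^* A`, so compression cannot increase the norm of the expectation
(`HasOperatorExpectation.norm_le_norm`). If the projections tend strongly to the identity, dominated
convergence gives weak convergence of the compressed expectations, and lower semicontinuity gives
convergence of norms (`tendsto_norm_of_tendsto_inner`).

Strong convergence holds once no nonzero `h` vanishes at all sample points. For one fixed `h` this
is independence, but there are uncountably many `h`. So `IsRandomPoint.exists_ball_ne_zero` finds an
event of positive probability that excludes zeros for a whole ball at once, and countably many such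
balls cover the nonzero elements (`ae_eq_zero_of_vanishing`). -/

noncomputable section

/-! ### Cancellation and factorization of monomials. -/

namespace IsMonomialMonoid

variable {ι Γ : Type*} [Monoid Γ] {gen : ι → Γ}

lemma countable [Countable ι] (hΓ : IsMonomialMonoid gen) : Countable Γ := by
  rcases hΓ with ⟨e, -⟩ | ⟨e, -⟩
  · exact e.symm.injective.countable
  · have : Countable (Multiplicative (ι →₀ ℕ)) := inferInstanceAs (Countable (ι →₀ ℕ))
    exact e.symm.injective.countable

lemma mul_right_cancel (hΓ : IsMonomialMonoid gen) {α β γ : Γ} (h : α * γ = β * γ) : α = β := by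
  rcases hΓ with ⟨e, -⟩ | ⟨e, -⟩
  · apply e.symm.injective
    have h' := congrArg e.symm h
    rw [map_mul, map_mul] at h'
    exact List.append_cancel_right h'
  · apply e.symm.injective
    have h' := congrArg e.symm h
    rw [map_mul, map_mul] at h'
    exact add_right_cancel (G := ι →₀ ℕ) h'

lemma mul_left_cancel (hΓ : IsMonomialMonoid gen) {α β γ : Γ} (h : γ * α = γ * β) : α = β := by
  rcases hΓ with ⟨e, -⟩ | ⟨e, -⟩
  · apply e.symm.injective
    have h' := congrArg e.symm h
    rw [map_mul, map_mul] at h'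
    exact List.append_cancel_left h'
  · apply e.symm.injective
    have h' := congrArg e.symm h
    rw [map_mul, map_mul] at h'
    exact add_left_cancel (G := ι →₀ ℕ) h'

lemma finite_factorizations (hΓ : IsMonomialMonoid gen) (γ : Γ) :
    {p : Γ × Γ | p.1 * p.2 = γ}.Finite := by
  classical
  rcases hΓ with ⟨e, -⟩ | ⟨e, -⟩
  -- A factorization of a word is a cut into prefix and suffix, with `length + 1` possible
  -- positions.
  · let l : List ι := FreeMonoid.toList (e.symm γ)
    refine ((Finset.range (l.length + 1)).finite_toSet.image fun k : ℕ =>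
      (e (FreeMonoid.ofList (l.take k)), e (FreeMonoid.ofList (l.drop k)))).subset ?_
    rintro ⟨a, b⟩ hab
    have hl : l = FreeMonoid.toList (e.symm a) ++ FreeMonoid.toList (e.symm b) := by
      have : a * b = γ := hab
      simp only [l, ← this, map_mul, FreeMonoid.toList_mul]
    refine ⟨(FreeMonoid.toList (e.symm a)).length, ?_, ?_⟩
    · simp only [Finset.coe_range, Set.mem_Iio, hl, List.length_append]
      omega
    · simp [hl]
  · let m : ι →₀ ℕ := Multiplicative.toAdd (e.symm γ)
    refine ((Finset.HasAntidiagonal.antidiagonal m).finite_toSet.image fun k =>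
      (e (Multiplicative.ofAdd k.1), e (Multiplicative.ofAdd k.2))).subset ?_
    rintro ⟨a, b⟩ hab
    refine ⟨(Multiplicative.toAdd (e.symm a), Multiplicative.toAdd (e.symm b)), ?_, ?_⟩
    · have : a * b = γ := hab
      simp only [Finset.mem_coe, Finset.HasAntidiagonal.mem_antidiagonal, m, ← this, map_mul, toAdd_mul]
    · simp

lemma exists_word (hΓ : IsMonomialMonoid gen) (γ : Γ) : ∃ l : List ι, (l.map gen).prod = γ := by
  classical
  rcases hΓ with ⟨e, he⟩ | ⟨e, he⟩
  · refine ⟨FreeMonoid.toList (e.symm γ), ?_⟩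
    have h : e.toMonoidHom = FreeMonoid.lift gen := FreeMonoid.hom_eq fun i => by simp [he]
    have h' := DFunLike.congr_fun h (e.symm γ)
    simpa [FreeMonoid.lift_apply] using h'.symm
  · suffices h : ∀ m : ι →₀ ℕ, ∃ l : List ι, (l.map gen).prod = e (Multiplicative.ofAdd m) by
      simpa using h (Multiplicative.toAdd (e.symm γ))
    intro m
    induction m using Finsupp.induction_linear with
    | zero => exact ⟨[], by simp⟩
    | add f g hf hg =>
      obtain ⟨l, hl⟩ := hf
      obtain ⟨l', hl'⟩ := hg
      exact ⟨l ++ l', by simp [hl, hl', ofAdd_add]⟩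
    | single i n =>
      refine ⟨List.replicate n i, ?_⟩
      rw [List.map_replicate, List.prod_replicate, ← he, ← map_pow, ← ofAdd_nsmul]
      simp

end IsMonomialMonoid

/-! ### Multiplication operators in the monomial basis. -/

section PowerSeries

variable {ι Γ H : Type*} [NormedAddCommGroup H] [InnerProductSpace ℂ H]

lemma PowerSeriesSpace.monomial_ne_zero (S : PowerSeriesSpace Γ H) (γ : Γ) : S.monomial γ ≠ 0 := by
  intro h
  simpa [h] using S.coeff_monomial_self γ

lemma PowerSeriesSpace.norm_monomial_pos (S : PowerSeriesSpace Γ H) (γ : Γ) :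
    0 < ‖S.monomial γ‖ :=
  norm_pos_iff.2 (S.monomial_ne_zero γ)

lemma PowerSeriesSpace.ext_inner_monomial (S : PowerSeriesSpace Γ H) {f g : H}
    (h : ∀ γ, ⟪S.monomial γ, f⟫_ℂ = ⟪S.monomial γ, g⟫_ℂ) : f = g := by
  refine ext_inner_left ℂ fun k => ?_
  have h1 : Continuous fun k : H => ⟪k, f⟫_ℂ := by fun_prop
  have h2 : Continuous fun k : H => ⟪k, g⟫_ℂ := by fun_prop
  refine congrFun (h1.ext_on S.dense_polynomials h2 fun k hk => ?_) k
  induction hk using Submodule.span_induction with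
  | mem k hk => obtain ⟨γ, rfl⟩ := hk; exact h γ
  | zero => simp
  | add a b _ _ ha hb => simp only [inner_add_left] at *; rw [ha, hb]
  | smul c a _ ha => simp only [inner_smul_left] at *; rw [ha]

lemma PowerSeriesSpace.finite_support_coeff (S : PowerSeriesSpace Γ H) {p : H}
    (hp : p ∈ Submodule.span ℂ (Set.range S.monomial)) : (Function.support (S.coeff p)).Finite := by
  classical
  induction hp using Submodule.span_induction with
  | mem k hk =>
    obtain ⟨γ, rfl⟩ := hk
    refine (Set.finite_singleton γ).subset fun δ hδ => ?_
    by_contra h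
    exact hδ (S.coeff_monomial_ne γ δ h)
  | zero => simp
  | add a b _ _ ha hb =>
    rw [map_add]
    exact (ha.union hb).subset (Function.support_add _ _)
  | smul c a _ ha =>
    rw [map_smul]
    exact ha.subset (Function.support_const_smul_subset _ _)

lemma PowerSeriesSpace.separableSpace [Countable Γ] (S : PowerSeriesSpace Γ H) :
    TopologicalSpace.SeparableSpace H := by
  rw [← TopologicalSpace.isSeparable_univ_iff, ← S.dense_polynomials.closure_eq]
  exact ((Set.countable_range S.monomial).isSeparable.span).closure

variable [Monoid Γ] {gen : ι → Γ} {S : PowerSeriesSpace Γ H}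

namespace IsCommitteeSpace

/-- Both sides are continuous in `h` and, by orthogonality, agree on monomials. -/
lemma inner_monomial (hS : IsCommitteeSpace S) (γ : Γ) (h : H) :
    ⟪S.monomial γ, h⟫_ℂ = (‖S.monomial γ‖ : ℂ) ^ 2 * S.coeff h γ := by
  classical
  have h1 : Continuous fun h : H => ⟪S.monomial γ, h⟫_ℂ := by fun_prop
  have h2 : Continuous fun h : H => (‖S.monomial γ‖ : ℂ) ^ 2 * S.coeff h γ :=
    continuous_const.mul (S.continuous_coeff γ)
  refine congrFun (h1.ext_on S.dense_polynomials h2 fun k hk => ?_) h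
  induction hk using Submodule.span_induction with
  | mem k hk =>
    obtain ⟨δ, rfl⟩ := hk
    by_cases hδ : γ = δ
    · subst hδ
      simp [S.coeff_monomial_self, inner_self_eq_norm_sq_to_K]
    · simp [hS.orthogonal γ δ hδ, S.coeff_monomial_ne δ γ hδ]
  | zero => simp
  | add a b _ _ ha hb =>
    simp only [inner_add_right, map_add, Pi.add_apply, mul_add] at *; rw [ha, hb]
  | smul c a _ ha =>
    simp only [inner_smul_right, map_smul, Pi.smul_apply, smul_eq_mul] at *; rw [ha]; ring

lemma orthonormal (hS : IsCommitteeSpace S) :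
    Orthonormal ℂ fun γ => (‖S.monomial γ‖⁻¹ : ℂ) • S.monomial γ := by
  refine ⟨fun γ => ?_, fun γ δ h => ?_⟩
  · rw [norm_smul, norm_inv, Complex.norm_real, norm_norm,
      inv_mul_cancel₀ (S.norm_monomial_pos γ).ne']
  · simp [inner_smul_left, inner_smul_right, hS.orthogonal γ δ h]

/-- The normalized monomials. -/
def basis [CompleteSpace H] (hS : IsCommitteeSpace S) : HilbertBasis Γ ℂ H :=
  HilbertBasis.mk hS.orthonormal (by
    rw [Submodule.topologicalClosure_eq_top_iff.2]
    rw [Submodule.eq_bot_iff]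
    intro h hh
    refine S.ext_inner_monomial fun γ => ?_
    have h' := Submodule.mem_orthogonal _ _ |>.1 hh _ (Submodule.subset_span ⟨γ, rfl⟩)
    have hne : (‖S.monomial γ‖ : ℂ) ≠ 0 := by exact_mod_cast (S.norm_monomial_pos γ).ne'
    simpa [inner_smul_left, hne, S.monomial_ne_zero] using h')

lemma basis_apply [CompleteSpace H] (hS : IsCommitteeSpace S) (γ : Γ) :
    hS.basis γ = (‖S.monomial γ‖⁻¹ : ℂ) • S.monomial γ := by
  simp [basis]

/-- The matrix of a multiplication operator. -/
lemma inner_mulOp_mul (hΓ : IsMonomialMonoid gen) (hS : IsCommitteeSpace S) {f : Γ → ℂ}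
    {T : H →L[ℂ] H} (hT : IsMulOp S f T) (γ δ : Γ) :
    ⟪S.monomial (γ * δ), T (S.monomial δ)⟫_ℂ = (‖S.monomial (γ * δ)‖ : ℂ) ^ 2 * f γ := by
  classical
  rw [hS.inner_monomial, hT, seriesMul, finsum_eq_single _ (γ, δ), finsum_eq_if]
  · simp [S.coeff_monomial_self]
  · rintro ⟨a, b⟩ hab
    rw [finsum_eq_if]
    split_ifs with h
    · have hb : b ≠ δ := by
        rintro rfl
        exact hab (congrArg (·, b) (hΓ.mul_right_cancel h))
      simp [S.coeff_monomial_ne δ b hb]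
    · rfl

lemma inner_mulOp_eq_zero (hS : IsCommitteeSpace S) {f : Γ → ℂ}
    {T : H →L[ℂ] H} (hT : IsMulOp S f T) {α δ : Γ} (h : ∀ γ, γ * δ ≠ α) :
    ⟪S.monomial α, T (S.monomial δ)⟫_ℂ = 0 := by
  classical
  rw [hS.inner_monomial, hT, seriesMul, finsum_eq_zero_of_forall_eq_zero, mul_zero]
  rintro ⟨a, b⟩
  rw [finsum_eq_if]
  split_ifs with h'
  · have hb : b ≠ δ := by
      rintro rfl
      exact h a h'
    simp [S.coeff_monomial_ne δ b hb]
  · rfl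

/-- Only right factors of `α` can occur, so adjoints preserve polynomials. This finite formula makes
both measurability and second moments accessible. -/
lemma adjoint_mulOp_monomial [CompleteSpace H] (hΓ : IsMonomialMonoid gen)
    (hS : IsCommitteeSpace S) {f : Γ → ℂ} {T : H →L[ℂ] H} (hT : IsMulOp S f T) (α : Γ) :
    ContinuousLinearMap.adjoint T (S.monomial α) =
      ∑ p ∈ (hΓ.finite_factorizations α).toFinset,
        ((‖S.monomial α‖ : ℂ) ^ 2 / (‖S.monomial p.2‖ : ℂ) ^ 2 * (starRingEnd ℂ) (f p.1)) •
          S.monomial p.2 := by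
  classical
  refine S.ext_inner_monomial fun δ => ?_
  rw [ContinuousLinearMap.adjoint_inner_right, ← inner_conj_symm, inner_sum]
  -- By right cancellation at most one factorization of `α` has right factor `δ`.
  by_cases h : ∃ γ, γ * δ = α
  · obtain ⟨γ, rfl⟩ := h
    have hne : (‖S.monomial δ‖ : ℂ) ≠ 0 := by exact_mod_cast (S.norm_monomial_pos δ).ne'
    rw [Finset.sum_eq_single (γ, δ), inner_mulOp_mul hΓ hS hT, inner_smul_right,
      inner_self_eq_norm_sq_to_K]
    · simp only [map_mul, map_pow, Complex.conj_ofReal, Complex.coe_algebraMap]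
      field_simp
    · rintro ⟨a, b⟩ hab hne
      have hb : δ ≠ b := by
        rintro rfl
        exact hne (congrArg (·, δ) (hΓ.mul_right_cancel (by simpa using hab)))
      rw [inner_smul_right, hS.orthogonal _ _ hb, mul_zero]
    · intro h
      simp at h
  · push Not at h
    rw [inner_mulOp_eq_zero hS hT h, map_zero, eq_comm]
    refine Finset.sum_eq_zero ?_
    rintro ⟨a, b⟩ hab
    have hb : δ ≠ b := by
      rintro rfl
      exact h a (by simpa using hab)
    rw [inner_smul_right, hS.orthogonal _ _ hb, mul_zero]

end IsCommitteeSpace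

lemma isMulOp_mulOp {f : Γ → ℂ} (hf : IsMultiplier S f) : IsMulOp S f (mulOp S f) := by
  rw [mulOp, dif_pos hf]
  exact hf.choose_spec

end PowerSeries

/-! ### Norms and weak expectations of operators. -/

section RandomOperators

variable {Ω H : Type*} [MeasurableSpace Ω] {P : Measure Ω} [NormedAddCommGroup H]
  [InnerProductSpace ℂ H]

lemma HilbertBasis.hasSum_norm_inner_sq {κ : Type*} (b : HilbertBasis κ ℂ H) (h : H) :
    HasSum (fun i => ‖⟪b i, h⟫_ℂ‖ ^ 2) (‖h‖ ^ 2) := by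
  have key := b.hasSum_inner_mul_inner h h
  rw [inner_self_eq_norm_sq_to_K] at key
  rw [← Complex.hasSum_ofReal]
  push_cast
  have hterm : ∀ i, (‖⟪b i, h⟫_ℂ‖ : ℂ) ^ 2 = ⟪h, b i⟫_ℂ * ⟪b i, h⟫_ℂ := fun i => by
    rw [← inner_conj_symm h (b i), Complex.conj_mul']
  simp only [hterm]
  exact key

/-- The norm of a diagonal operator. -/
lemma HilbertBasis.norm_le_of_diagonal [CompleteSpace H] {κ : Type*} (b : HilbertBasis κ ℂ H)
    {R : H →L[ℂ] H} {c : ℝ} (hc : 0 ≤ c) (hoff : ∀ i j, i ≠ j → ⟪b i, R (b j)⟫_ℂ = 0)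
    (hdiag : ∀ i, ‖⟪b i, R (b i)⟫_ℂ‖ ≤ c) : ‖R‖ ≤ c := by
  refine R.opNorm_le_bound hc fun h => ?_
  have hentry : ∀ i, ⟪b i, R h⟫_ℂ = ⟪b i, R (b i)⟫_ℂ * ⟪b i, h⟫_ℂ := by
    -- Parseval applied to `R^* b_i` and `h`; only the `i`-th term survives.
    intro i
    have h1 := b.hasSum_inner_mul_inner (ContinuousLinearMap.adjoint R (b i)) h
    simp only [ContinuousLinearMap.adjoint_inner_left] at h1
    exact h1.unique (hasSum_single i fun j hj => by rw [hoff i j hj.symm, zero_mul])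
  have h2 : ‖R h‖ ^ 2 ≤ (c * ‖h‖) ^ 2 := by
    rw [mul_pow]
    refine hasSum_le (fun i => ?_) (b.hasSum_norm_inner_sq (R h))
      ((b.hasSum_norm_inner_sq h).mul_left (c ^ 2))
    rw [hentry, norm_mul, mul_pow]
    gcongr
    exact hdiag i
  exact (pow_le_pow_iff_left₀ (by positivity) (by positivity) two_ne_zero).1 h2

lemma aestronglyMeasurable_of_inner_basis [CompleteSpace H] {κ : Type*} [Countable κ]
    (b : HilbertBasis κ ℂ H) {f : Ω → H}
    (hf : ∀ i, AEStronglyMeasurable (fun ω => ⟪b i, f ω⟫_ℂ) P) : AEStronglyMeasurable f P := by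
  refine aestronglyMeasurable_of_tendsto_ae (atTop : Filter (Finset κ))
    (f := fun s ω => ∑ i ∈ s, ⟪b i, f ω⟫_ℂ • b i) (fun s => ?_) (ae_of_all _ fun ω => ?_)
  · exact Finset.aestronglyMeasurable_fun_sum s fun i _ => (hf i).smul aestronglyMeasurable_const
  · have := b.hasSum_repr (f ω)
    simp only [b.repr_apply_apply] at this
    exact this

/-- The averaged sesquilinear form is bounded, hence represented by an operator. -/
lemma exists_hasOperatorExpectation [CompleteSpace H] [IsFiniteMeasure P] {T : Ω → H →L[ℂ] H}
    (hm : ∀ g h, AEStronglyMeasurable (fun ω => ⟪g, T ω h⟫_ℂ) P) {C : ℝ}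
    (hb : ∀ᵐ ω ∂P, ‖T ω‖ ≤ C) : ∃ R, HasOperatorExpectation P T R := by
  have hbound : ∀ g h, ∀ᵐ ω ∂P, ‖⟪g, T ω h⟫_ℂ‖ ≤ ‖g‖ * (C * ‖h‖) := by
    intro g h
    filter_upwards [hb] with ω hω
    refine (norm_inner_le_norm _ _).trans ?_
    gcongr
    exact (T ω).le_of_opNorm_le hω h
  have hint : ∀ g h, Integrable (fun ω => ⟪g, T ω h⟫_ℂ) P := fun g h =>
    Integrable.of_bound (hm g h) _ (hbound g h)
  let B₀ : H →ₗ⋆[ℂ] H →ₗ[ℂ] ℂ := LinearMap.mk₂'ₛₗ (starRingEnd ℂ) (RingHom.id ℂ)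
    (fun g h => ∫ ω, ⟪g, T ω h⟫_ℂ ∂P)
    (fun g₁ g₂ h => by
      simp only [inner_add_left]
      exact integral_add (hint g₁ h) (hint g₂ h))
    (fun c g h => by
      simp only [inner_smul_left, smul_eq_mul]
      exact integral_const_mul _ _)
    (fun g h₁ h₂ => by
      simp only [map_add, inner_add_right]
      exact integral_add (hint g h₁) (hint g h₂))
    (fun c g h => by
      simp only [map_smul, inner_smul_right, smul_eq_mul, RingHom.id_apply]
      exact integral_const_mul _ _)
  let B : H →L⋆[ℂ] H →L[ℂ] ℂ := LinearMap.mkContinuous₂ B₀ (C * P.real Set.univ) fun g h => by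
    calc ‖∫ ω, ⟪g, T ω h⟫_ℂ ∂P‖ ≤ ‖g‖ * (C * ‖h‖) * P.real Set.univ :=
          norm_integral_le_of_norm_le_const (hbound g h)
      _ = C * P.real Set.univ * ‖g‖ * ‖h‖ := by ring
  refine ⟨ContinuousLinearMap.adjoint (InnerProductSpace.continuousLinearMapOfBilin B),
    fun g h => ⟨hint g h, ?_⟩⟩
  rw [ContinuousLinearMap.adjoint_inner_right,
    InnerProductSpace.continuousLinearMapOfBilin_apply]
  rfl

lemma hasOperatorExpectation_operatorExpectation {T : Ω → H →L[ℂ] H}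
    (h : ∃ R, HasOperatorExpectation P T R) :
    HasOperatorExpectation P T (operatorExpectation P T) := by
  rw [operatorExpectation, dif_pos h]
  exact h.choose_spec

/-- Test on a unit vector `k` and the normalized `R k`. A bound by a sum of squares integrates
termwise, so no Cauchy–Schwarz inequality for expectations is needed. -/
lemma ContinuousLinearMap.norm_le_of_norm_inner_le {R : H →L[ℂ] H} {c : ℝ} (hc : 0 ≤ c)
    (h : ∀ g k, ‖⟪g, R k⟫_ℂ‖ ≤ c * (‖g‖ ^ 2 + ‖k‖ ^ 2) / 2) : ‖R‖ ≤ c := by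
  refine ContinuousLinearMap.opNorm_le_of_unit_norm hc fun k hk => ?_
  by_cases h0 : R k = 0
  · simpa [h0] using hc
  have hpos : 0 < ‖R k‖ := norm_pos_iff.2 h0
  have h1 := h ((‖R k‖⁻¹ : ℂ) • R k) k
  rw [inner_smul_left, inner_self_eq_norm_sq_to_K, norm_smul, hk] at h1
  simp only [map_inv₀, Complex.conj_ofReal, Complex.coe_algebraMap, norm_mul, norm_inv, norm_pow,
    Complex.norm_real, norm_norm, inv_mul_cancel₀ hpos.ne'] at h1
  have h2 : ‖R k‖⁻¹ * ‖R k‖ ^ 2 = ‖R k‖ := by field_simp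
  rw [h2] at h1
  linarith

lemma HasOperatorExpectation.re_inner_eq {T A : Ω → H →L[ℂ] H} {R : H →L[ℂ] H}
    (hR : HasOperatorExpectation P T R)
    (hT : ∀ ω g h, ⟪g, T ω h⟫_ℂ = ⟪A ω g, A ω h⟫_ℂ) (h : H) :
    Integrable (fun ω => ‖A ω h‖ ^ 2) P ∧ (⟪h, R h⟫_ℂ).re = ∫ ω, ‖A ω h‖ ^ 2 ∂P := by
  obtain ⟨hi, he⟩ := hR h h
  have hre : ∀ ω, (⟪h, T ω h⟫_ℂ).re = ‖A ω h‖ ^ 2 := fun ω => by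
    rw [hT, ← inner_self_eq_norm_sq (𝕜 := ℂ)]; rfl
  refine ⟨hi.re.congr (ae_of_all _ hre), ?_⟩
  rw [← he]
  exact (integral_re hi).symm.trans (integral_congr_ae (ae_of_all _ hre))

/-- Compression decreases the norm of an expectation of positive operators. -/
lemma HasOperatorExpectation.norm_le_norm {T T' A A' : Ω → H →L[ℂ] H} {R R' Q : H →L[ℂ] H}
    (hR : HasOperatorExpectation P T R) (hR' : HasOperatorExpectation P T' R')
    (hT : ∀ ω g h, ⟪g, T ω h⟫_ℂ = ⟪A ω g, A ω h⟫_ℂ)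
    (hT' : ∀ ω g h, ⟪g, T' ω h⟫_ℂ = ⟪A' ω g, A' ω h⟫_ℂ)
    (hA : ∀ ω h, ‖A' ω h‖ ≤ ‖A ω (Q h)‖) (hQ : ∀ h, ‖Q h‖ ≤ ‖h‖) : ‖R'‖ ≤ ‖R‖ := by
  have hsq : ∀ h, Integrable (fun ω => ‖A ω (Q h)‖ ^ 2) P ∧
      ∫ ω, ‖A ω (Q h)‖ ^ 2 ∂P ≤ ‖R‖ * ‖h‖ ^ 2 := by
    intro h
    obtain ⟨hi, he⟩ := hR.re_inner_eq hT (Q h)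
    refine ⟨hi, he ▸ ?_⟩
    calc (⟪Q h, R (Q h)⟫_ℂ).re ≤ ‖⟪Q h, R (Q h)⟫_ℂ‖ := Complex.re_le_norm _
      _ ≤ ‖Q h‖ * ‖R (Q h)‖ := norm_inner_le_norm _ _
      _ ≤ ‖h‖ * (‖R‖ * ‖h‖) := by
        gcongr
        · exact hQ h
        · exact (R.le_opNorm _).trans (by gcongr; exact hQ h)
      _ = ‖R‖ * ‖h‖ ^ 2 := by ring
  refine ContinuousLinearMap.norm_le_of_norm_inner_le (norm_nonneg _) fun g k => ?_
  obtain ⟨hig, hg⟩ := hsq g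
  obtain ⟨hik, hk⟩ := hsq k
  rw [← (hR' g k).2]
  calc ‖∫ ω, ⟪g, T' ω k⟫_ℂ ∂P‖
      ≤ ∫ ω, (‖A ω (Q g)‖ ^ 2 + ‖A ω (Q k)‖ ^ 2) / 2 ∂P := by
        refine norm_integral_le_of_norm_le ((hig.add hik).div_const 2) (ae_of_all _ fun ω => ?_)
        rw [hT']
        have h1 := norm_inner_le_norm (𝕜 := ℂ) (A' ω g) (A' ω k)
        have h2 := mul_le_mul (hA ω g) (hA ω k) (norm_nonneg _) (norm_nonneg _)
        have h3 := two_mul_le_add_sq ‖A ω (Q g)‖ ‖A ω (Q k)‖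
        linarith
    _ = (∫ ω, ‖A ω (Q g)‖ ^ 2 ∂P + ∫ ω, ‖A ω (Q k)‖ ^ 2 ∂P) / 2 := by
        rw [integral_div, integral_add hig hik]
    _ ≤ ‖R‖ * (‖g‖ ^ 2 + ‖k‖ ^ 2) / 2 := by linarith

/-- Lower semicontinuity of the norm under weak convergence. -/
lemma tendsto_norm_of_tendsto_inner {R : H →L[ℂ] H} {Rn : ℕ → H →L[ℂ] H}
    (hle : ∀ n, ‖Rn n‖ ≤ ‖R‖)
    (hw : ∀ g h, Tendsto (fun n => ⟪g, Rn n h⟫_ℂ) atTop (𝓝 ⟪g, R h⟫_ℂ)) :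
    Tendsto (fun n => ‖Rn n‖) atTop (𝓝 ‖R‖) := by
  refine tendsto_order.2 ⟨fun a ha => ?_, fun a ha => .of_forall fun n => (hle n).trans_lt ha⟩
  rcases lt_or_ge a 0 with h0 | h0
  · exact .of_forall fun n => h0.trans_le (norm_nonneg _)
  -- This `h` witnesses `a < ‖R‖`; pairing with `R h` transfers the strict bound to `Rn n`.
  obtain ⟨h, hh⟩ : ∃ h, a * ‖h‖ < ‖R h‖ := by
    by_contra! hcon
    exact ha.not_ge (R.opNorm_le_bound h0 hcon)
  have hpos : 0 < ‖R h‖ := (by positivity : 0 ≤ a * ‖h‖).trans_lt hh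
  have hlim := (hw (R h) h).norm
  rw [inner_self_eq_norm_sq_to_K, norm_pow, RCLike.norm_ofReal, abs_norm] at hlim
  have hlt : ‖R h‖ * (a * ‖h‖) < ‖R h‖ ^ 2 := by rw [sq]; gcongr
  filter_upwards [hlim.eventually_const_lt hlt] with n hn
  have h1 : ‖R h‖ * (a * ‖h‖) < ‖R h‖ * (‖Rn n‖ * ‖h‖) :=
    hn.trans_le ((norm_inner_le_norm _ _).trans (by gcongr; exact (Rn n).le_opNorm h))
  exact lt_of_mul_lt_mul_right (lt_of_mul_lt_mul_left h1 hpos.le) (norm_nonneg _)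

end RandomOperators

/-! ### Compressions by projections. -/

section StarProjections

variable {Γ H Ω : Type*} [NormedAddCommGroup H] [InnerProductSpace ℂ H] [CompleteSpace H]

lemma IsStarProjection.norm_apply_le {Q : H →L[ℂ] H} (hQ : IsStarProjection Q) (h : H) :
    ‖Q h‖ ≤ ‖h‖ := by
  obtain ⟨K, _, rfl⟩ := isStarProjection_iff_eq_starProjection.1 hQ
  exact K.norm_starProjection_apply_le h

lemma IsStarProjection.inner_apply_left {Q : H →L[ℂ] H} (hQ : IsStarProjection Q) (g h : H) :
    ⟪Q g, h⟫_ℂ = ⟪g, Q h⟫_ℂ := by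
  rw [← ContinuousLinearMap.adjoint_inner_left, hQ.isSelfAdjoint.adjoint_eq]

lemma IsStarProjection.apply_apply {Q : H →L[ℂ] H} (hQ : IsStarProjection Q) (h : H) :
    Q (Q h) = Q h :=
  DFunLike.congr_fun hQ.isIdempotentElem h

/-- Contractivity lets the argument vary with `n`; iterating this handles products of strongly
convergent factors. -/
lemma IsStarProjection.tendsto_apply {Q : ℕ → H →L[ℂ] H} (hQ : ∀ n, IsStarProjection (Q n))
    (hlim : ∀ h, Tendsto (fun n => Q n h) atTop (𝓝 h)) {f : ℕ → H} {g : H}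
    (hf : Tendsto f atTop (𝓝 g)) : Tendsto (fun n => Q n (f n)) atTop (𝓝 g) := by
  have h1 : Tendsto (fun n => Q n (f n - g)) atTop (𝓝 0) := by
    refine squeeze_zero_norm (fun n => (hQ n).norm_apply_le _) ?_
    simpa using (hf.sub_const g).norm
  simpa using h1.add (hlim g)

variable [Monoid Γ] {S : PowerSeriesSpace Γ H} {v : Γ → Ω → ℂ}

/-- The form `A^* A` with `A = Q M_f^* Q`, by `Q^* = Q = Q²`. -/
lemma inner_rowTerm {Q : H →L[ℂ] H} (hQ : IsStarProjection Q) (ω : Ω) (g h : H) :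
    ⟪g, rowTerm S v Q ω h⟫_ℂ =
      ⟪(Q ∘L ContinuousLinearMap.adjoint (mulOp S fun γ => v γ ω) ∘L Q) g,
        (Q ∘L ContinuousLinearMap.adjoint (mulOp S fun γ => v γ ω) ∘L Q) h⟫_ℂ := by
  simp only [rowTerm, ContinuousLinearMap.comp_apply]
  rw [hQ.inner_apply_left, hQ.apply_apply, ContinuousLinearMap.adjoint_inner_left,
    hQ.inner_apply_left]

lemma inner_colTerm {Q : H →L[ℂ] H} (hQ : IsStarProjection Q) (ω : Ω) (g h : H) :
    ⟪g, colTerm S v Q ω h⟫_ℂ =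
      ⟪(Q ∘L (mulOp S fun γ => v γ ω) ∘L Q) g, (Q ∘L (mulOp S fun γ => v γ ω) ∘L Q) h⟫_ℂ := by
  simp only [colTerm, ContinuousLinearMap.comp_apply]
  rw [hQ.inner_apply_left, hQ.apply_apply, ← ContinuousLinearMap.adjoint_inner_right,
    hQ.inner_apply_left]

end StarProjections

/-! ### Existence, monotonicity and convergence of the expectations. -/

section RandomMultipliers

variable {ι Γ H Ω : Type*} [Monoid Γ] {gen : ι → Γ} [NormedAddCommGroup H] [InnerProductSpace ℂ H]
  [CompleteSpace H] {S : PowerSeriesSpace Γ H} [MeasurableSpace Ω] {P : Measure Ω}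
  {v : Γ → Ω → ℂ}

namespace IsRandomMultiplierModel

/-- The constant does not depend on `Q`, as dominated convergence along a sequence of projections
requires. -/
lemma exists_norm_term_le (hv : IsRandomMultiplierModel S P v) :
    ∃ C : ℝ, ∀ Q : H →L[ℂ] H, IsStarProjection Q → ∀ᵐ ω ∂P,
      ‖rowTerm S v Q ω‖ ≤ C ∧ ‖colTerm S v Q ω‖ ≤ C := by
  obtain ⟨C, hC0, hC⟩ := hv.bounded
  refine ⟨C * C, fun Q hQ => ?_⟩
  filter_upwards [hC] with ω hω
  have hM : ∀ h, ‖mulOp S (fun γ => v γ ω) h‖ ≤ C * ‖h‖ :=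
    (mulOp S fun γ => v γ ω).le_of_opNorm_le hω.2
  have hM' : ∀ h, ‖ContinuousLinearMap.adjoint (mulOp S fun γ => v γ ω) h‖ ≤ C * ‖h‖ :=
    ContinuousLinearMap.le_of_opNorm_le _ (by rw [LinearIsometryEquiv.norm_map]; exact hω.2)
  refine ⟨ContinuousLinearMap.opNorm_le_bound _ (by positivity) fun h => ?_,
    ContinuousLinearMap.opNorm_le_bound _ (by positivity) fun h => ?_⟩
  · simp only [rowTerm, ContinuousLinearMap.comp_apply]
    refine (hQ.norm_apply_le _).trans ((hM _).trans ?_)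
    rw [mul_assoc]
    gcongr
    exact (hQ.norm_apply_le _).trans ((hM' _).trans (by gcongr; exact hQ.norm_apply_le h))
  · simp only [colTerm, ContinuousLinearMap.comp_apply]
    refine (hQ.norm_apply_le _).trans ((hM' _).trans ?_)
    rw [mul_assoc]
    gcongr
    exact (hQ.norm_apply_le _).trans ((hM _).trans (by gcongr; exact hQ.norm_apply_le h))

variable [Countable Γ]

lemma aestronglyMeasurable_mulOp_apply (hΓ : IsMonomialMonoid gen) (hS : IsCommitteeSpace S)
    (hv : IsRandomMultiplierModel S P v) (h : H) :
    AEStronglyMeasurable (fun ω => mulOp S (fun γ => v γ ω) h) P := by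
  obtain ⟨C, -, hC⟩ := hv.bounded
  refine aestronglyMeasurable_of_inner_basis hS.basis fun α => ?_
  -- `mulOp` comes from a choice at each `ω`; moving it to the basis vector expresses the entry by
  -- finitely many `v γ`.
  simp only [← ContinuousLinearMap.adjoint_inner_left, hS.basis_apply, map_smul]
  refine AEStronglyMeasurable.inner (.const_smul (.congr (f := fun ω =>
    ∑ p ∈ (hΓ.finite_factorizations α).toFinset,
      ((‖S.monomial α‖ : ℂ) ^ 2 / (‖S.monomial p.2‖ : ℂ) ^ 2 * (starRingEnd ℂ) (v p.1 ω)) •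
          S.monomial p.2) ?_ ?_) _) aestronglyMeasurable_const
  · refine Finset.aestronglyMeasurable_fun_sum _ fun p _ => .smul (.const_mul ?_ _)
      aestronglyMeasurable_const
    exact Complex.continuous_conj.comp_aestronglyMeasurable (hv.memLp p.1).1
  · filter_upwards [hC] with ω hω
    exact (hS.adjoint_mulOp_monomial hΓ (isMulOp_mulOp hω.1) α).symm

lemma aestronglyMeasurable_adjoint_mulOp_apply (hΓ : IsMonomialMonoid gen)
    (hS : IsCommitteeSpace S) (hv : IsRandomMultiplierModel S P v) (h : H) :
    AEStronglyMeasurable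
      (fun ω => ContinuousLinearMap.adjoint (mulOp S fun γ => v γ ω) h) P := by
  refine aestronglyMeasurable_of_inner_basis hS.basis fun α => ?_
  simp only [ContinuousLinearMap.adjoint_inner_right]
  exact (hv.aestronglyMeasurable_mulOp_apply hΓ hS _).inner aestronglyMeasurable_const

variable [IsProbabilityMeasure P]

lemma hasOperatorExpectation_rowOp (hΓ : IsMonomialMonoid gen) (hS : IsCommitteeSpace S)
    (hv : IsRandomMultiplierModel S P v) {Q : H →L[ℂ] H} (hQ : IsStarProjection Q) :
    HasOperatorExpectation P (rowTerm S v Q) (rowOp S P v Q) := by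
  obtain ⟨C, hC⟩ := hv.exists_norm_term_le
  refine hasOperatorExpectation_operatorExpectation
    (exists_hasOperatorExpectation (fun g h => ?_) ((hC Q hQ).mono fun ω hω => hω.1))
  simp only [inner_rowTerm hQ, ContinuousLinearMap.comp_apply]
  exact (Q.continuous.comp_aestronglyMeasurable
    (hv.aestronglyMeasurable_adjoint_mulOp_apply hΓ hS _)).inner
    (Q.continuous.comp_aestronglyMeasurable (hv.aestronglyMeasurable_adjoint_mulOp_apply hΓ hS _))

lemma hasOperatorExpectation_colOp (hΓ : IsMonomialMonoid gen) (hS : IsCommitteeSpace S)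
    (hv : IsRandomMultiplierModel S P v) {Q : H →L[ℂ] H} (hQ : IsStarProjection Q) :
    HasOperatorExpectation P (colTerm S v Q) (colOp S P v Q) := by
  obtain ⟨C, hC⟩ := hv.exists_norm_term_le
  refine hasOperatorExpectation_operatorExpectation
    (exists_hasOperatorExpectation (fun g h => ?_) ((hC Q hQ).mono fun ω hω => hω.2))
  simp only [inner_colTerm hQ, ContinuousLinearMap.comp_apply]
  exact (Q.continuous.comp_aestronglyMeasurable
    (hv.aestronglyMeasurable_mulOp_apply hΓ hS _)).inner
    (Q.continuous.comp_aestronglyMeasurable (hv.aestronglyMeasurable_mulOp_apply hΓ hS _))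

lemma norm_rowOp_le (hΓ : IsMonomialMonoid gen) (hS : IsCommitteeSpace S)
    (hv : IsRandomMultiplierModel S P v) {Q : H →L[ℂ] H} (hQ : IsStarProjection Q) :
    ‖rowOp S P v Q‖ ≤ ‖rowOp S P v 1‖ :=
  (hv.hasOperatorExpectation_rowOp hΓ hS (.one _)).norm_le_norm
    (hv.hasOperatorExpectation_rowOp hΓ hS hQ) (inner_rowTerm (.one _)) (inner_rowTerm hQ)
    (fun _ _ => hQ.norm_apply_le _) hQ.norm_apply_le

lemma norm_colOp_le (hΓ : IsMonomialMonoid gen) (hS : IsCommitteeSpace S)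
    (hv : IsRandomMultiplierModel S P v) {Q : H →L[ℂ] H} (hQ : IsStarProjection Q) :
    ‖colOp S P v Q‖ ≤ ‖colOp S P v 1‖ :=
  (hv.hasOperatorExpectation_colOp hΓ hS (.one _)).norm_le_norm
    (hv.hasOperatorExpectation_colOp hΓ hS hQ) (inner_colTerm (.one _)) (inner_colTerm hQ)
    (fun _ _ => hQ.norm_apply_le _) hQ.norm_apply_le

lemma tendsto_norm_rowOp (hΓ : IsMonomialMonoid gen) (hS : IsCommitteeSpace S)
    (hv : IsRandomMultiplierModel S P v) {Q : ℕ → H →L[ℂ] H} (hQ : ∀ n, IsStarProjection (Q n))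
    (hlim : ∀ h, Tendsto (fun n => Q n h) atTop (𝓝 h)) :
    Tendsto (fun n => ‖rowOp S P v (Q n)‖) atTop (𝓝 ‖rowOp S P v 1‖) := by
  obtain ⟨C, hC⟩ := hv.exists_norm_term_le
  refine tendsto_norm_of_tendsto_inner (fun n => hv.norm_rowOp_le hΓ hS (hQ n)) fun g h => ?_
  have hE : ∀ n, HasOperatorExpectation P (rowTerm S v (Q n)) (rowOp S P v (Q n)) :=
    fun n => hv.hasOperatorExpectation_rowOp hΓ hS (hQ n)
  simp only [← (hE _ g h).2, ← (hv.hasOperatorExpectation_rowOp hΓ hS (.one _) g h).2]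
  refine tendsto_integral_of_dominated_convergence (fun _ => ‖g‖ * (C * ‖h‖))
    (fun n => (hE n g h).1.1) (integrable_const _) (fun n => ?_) (ae_of_all _ fun ω => ?_)
  · filter_upwards [hC _ (hQ n)] with ω hω
    refine (norm_inner_le_norm _ _).trans ?_
    gcongr
    exact ContinuousLinearMap.le_of_opNorm_le _ hω.1 h
  · refine tendsto_const_nhds.inner ?_
    simp only [rowTerm, ContinuousLinearMap.comp_apply]
    have := (ContinuousLinearMap.continuous
      (ContinuousLinearMap.adjoint (mulOp S fun γ => v γ ω))).tendsto h
    exact IsStarProjection.tendsto_apply hQ hlim (((mulOp S fun γ => v γ ω).continuous.tendsto _).comp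
      (IsStarProjection.tendsto_apply hQ hlim (this.comp (hlim h))))

lemma tendsto_norm_colOp (hΓ : IsMonomialMonoid gen) (hS : IsCommitteeSpace S)
    (hv : IsRandomMultiplierModel S P v) {Q : ℕ → H →L[ℂ] H} (hQ : ∀ n, IsStarProjection (Q n))
    (hlim : ∀ h, Tendsto (fun n => Q n h) atTop (𝓝 h)) :
    Tendsto (fun n => ‖colOp S P v (Q n)‖) atTop (𝓝 ‖colOp S P v 1‖) := by
  obtain ⟨C, hC⟩ := hv.exists_norm_term_le
  refine tendsto_norm_of_tendsto_inner (fun n => hv.norm_colOp_le hΓ hS (hQ n)) fun g h => ?_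
  have hE : ∀ n, HasOperatorExpectation P (colTerm S v (Q n)) (colOp S P v (Q n)) :=
    fun n => hv.hasOperatorExpectation_colOp hΓ hS (hQ n)
  simp only [← (hE _ g h).2, ← (hv.hasOperatorExpectation_colOp hΓ hS (.one _) g h).2]
  refine tendsto_integral_of_dominated_convergence (fun _ => ‖g‖ * (C * ‖h‖))
    (fun n => (hE n g h).1.1) (integrable_const _) (fun n => ?_) (ae_of_all _ fun ω => ?_)
  · filter_upwards [hC _ (hQ n)] with ω hω
    refine (norm_inner_le_norm _ _).trans ?_
    gcongr
    exact ContinuousLinearMap.le_of_opNorm_le _ hω.2 h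
  · refine tendsto_const_nhds.inner ?_
    simp only [colTerm, ContinuousLinearMap.comp_apply]
    have := (ContinuousLinearMap.continuous
      (ContinuousLinearMap.adjoint (mulOp S fun γ => v γ ω))).tendsto
    exact IsStarProjection.tendsto_apply hQ hlim ((this _).comp (IsStarProjection.tendsto_apply hQ hlim
      (((mulOp S fun γ => v γ ω).continuous.tendsto _).comp (hlim h))))

end IsRandomMultiplierModel

end RandomMultipliers

/-! ### The row-column inequality. -/

section RowColumnInequality

variable {ι Γ H Ω : Type*} [Monoid Γ] {gen : ι → Γ} [NormedAddCommGroup H] [InnerProductSpace ℂ H]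
  [CompleteSpace H] {S : PowerSeriesSpace Γ H} [MeasurableSpace Ω] {P : Measure Ω}
  {v : Γ → Ω → ℂ} [Countable Γ] [IsProbabilityMeasure P]

namespace IsRandomMultiplierModel

/-- Evaluate the form of `C_v` at the unit vector `1`, where it equals `E‖M_f 1‖²`, and apply
Bessel's inequality pointwise. -/
lemma sum_norm_sq_le_norm_colOp (hΓ : IsMonomialMonoid gen) (hS : IsCommitteeSpace S)
    (hone : ‖S.monomial 1‖ = 1) (hv : IsRandomMultiplierModel S P v) (F : Finset Γ) :
    ∑ γ ∈ F, ‖S.monomial γ‖ ^ 2 * ∫ ω, ‖v γ ω‖ ^ 2 ∂P ≤ ‖colOp S P v 1‖ := by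
  obtain ⟨C, -, hC⟩ := hv.bounded
  obtain ⟨hi, he⟩ := (hv.hasOperatorExpectation_colOp hΓ hS (.one _)).re_inner_eq
    (inner_colTerm (.one _)) (S.monomial 1)
  have hsq : ∀ γ, Integrable (fun ω => ‖S.monomial γ‖ ^ 2 * ‖v γ ω‖ ^ 2) P := fun γ =>
    (hv.memLp γ).integrable_norm_pow two_ne_zero |>.const_mul _
  calc ∑ γ ∈ F, ‖S.monomial γ‖ ^ 2 * ∫ ω, ‖v γ ω‖ ^ 2 ∂P
      = ∫ ω, ∑ γ ∈ F, ‖S.monomial γ‖ ^ 2 * ‖v γ ω‖ ^ 2 ∂P := by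
        rw [integral_finsetSum _ fun γ _ => hsq γ]
        simp only [integral_const_mul]
    _ ≤ (⟪S.monomial 1, colOp S P v 1 (S.monomial 1)⟫_ℂ).re := by
        rw [he]
        refine integral_mono_ae (integrable_finsetSum _ fun γ _ => hsq γ) hi ?_
        filter_upwards [hC] with ω hω
        refine le_trans (le_of_eq ?_) (hS.orthonormal.sum_inner_products_le (s := F) _)
        refine Finset.sum_congr rfl fun γ _ => ?_
        have hentry := hS.inner_mulOp_mul hΓ (isMulOp_mulOp hω.1) γ 1
        rw [mul_one] at hentry
        simp only [ContinuousLinearMap.comp_apply, one_apply_eq_self,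
          inner_smul_left, hentry, norm_mul, norm_pow, map_inv₀, Complex.conj_ofReal, norm_inv,
          Complex.norm_real, norm_norm]
        have := (S.norm_monomial_pos γ).ne'
        field_simp
    _ ≤ ‖⟪S.monomial 1, colOp S P v 1 (S.monomial 1)⟫_ℂ‖ := Complex.re_le_norm _
    _ ≤ ‖S.monomial 1‖ * (‖colOp S P v 1‖ * ‖S.monomial 1‖) :=
        (norm_inner_le_norm _ _).trans (by gcongr; exact ContinuousLinearMap.le_opNorm _ _)
    _ = ‖colOp S P v 1‖ := by rw [hone]; ring

lemma inner_rowOp_monomial (hΓ : IsMonomialMonoid gen) (hS : IsCommitteeSpace S)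
    (hv : IsRandomMultiplierModel S P v) (α β : Γ) :
    ⟪S.monomial α, rowOp S P v 1 (S.monomial β)⟫_ℂ =
      ∑ p ∈ (hΓ.finite_factorizations α).toFinset, ∑ q ∈ (hΓ.finite_factorizations β).toFinset,
        ((‖S.monomial α‖ : ℂ) ^ 2 / (‖S.monomial p.2‖ : ℂ) ^ 2 *
          ((‖S.monomial β‖ : ℂ) ^ 2 / (‖S.monomial q.2‖ : ℂ) ^ 2) *
          ⟪S.monomial p.2, S.monomial q.2⟫_ℂ) *
        ∫ ω, (starRingEnd ℂ) (v q.1 ω) * v p.1 ω ∂P := by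
  obtain ⟨C, -, hC⟩ := hv.bounded
  have hint : ∀ γ δ, Integrable (fun ω => (starRingEnd ℂ) (v γ ω) * v δ ω) P := fun γ δ =>
    (hv.memLp γ).star.integrable_mul (hv.memLp δ)
  rw [← (hv.hasOperatorExpectation_rowOp hΓ hS (.one _) _ _).2]
  simp only [← integral_const_mul]
  rw [integral_congr_ae (g := fun ω => ∑ p ∈ (hΓ.finite_factorizations α).toFinset,
    ∑ q ∈ (hΓ.finite_factorizations β).toFinset,
        ((‖S.monomial α‖ : ℂ) ^ 2 / (‖S.monomial p.2‖ : ℂ) ^ 2 *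
          ((‖S.monomial β‖ : ℂ) ^ 2 / (‖S.monomial q.2‖ : ℂ) ^ 2) *
          ⟪S.monomial p.2, S.monomial q.2⟫_ℂ) * ((starRingEnd ℂ) (v q.1 ω) * v p.1 ω)),
    integral_finsetSum _ fun p _ => integrable_finsetSum _ fun q _ => (hint _ _).const_mul _]
  · exact Finset.sum_congr rfl fun p _ =>
      integral_finsetSum _ fun q _ => (hint _ _).const_mul _
  · filter_upwards [hC] with ω hω
    rw [inner_rowTerm (.one _)]
    simp only [ContinuousLinearMap.comp_apply, one_apply_eq_self,
      hS.adjoint_mulOp_monomial hΓ (isMulOp_mulOp hω.1), sum_inner, inner_sum, inner_smul_left,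
      inner_smul_right, map_mul, map_div₀, map_pow, Complex.conj_ofReal, Complex.conj_conj]
    simp only [Finset.mul_sum]
    rw [Finset.sum_comm]
    refine Finset.sum_congr rfl fun p _ => ?_
    refine Finset.sum_congr rfl fun q _ => ?_
    ring

lemma inner_rowOp_monomial_of_ne (hΓ : IsMonomialMonoid gen) (hS : IsCommitteeSpace S)
    (hv : IsRandomMultiplierModel S P v) {α β : Γ} (h : α ≠ β) :
    ⟪S.monomial α, rowOp S P v 1 (S.monomial β)⟫_ℂ = 0 := by
  rw [hv.inner_rowOp_monomial hΓ hS]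
  refine Finset.sum_eq_zero fun p hp => Finset.sum_eq_zero fun q hq => ?_
  have hp' : p.1 * p.2 = α := by simpa using hp
  have hq' : q.1 * q.2 = β := by simpa using hq
  by_cases h2 : p.2 = q.2
  · rw [hv.uncorrelated, mul_zero]
    intro h1
    exact h (by rw [← hp', ← hq', h1, h2])
  · rw [hS.orthogonal _ _ h2, mul_zero, zero_mul]

lemma norm_inner_rowOp_monomial_self_le (hΓ : IsMonomialMonoid gen) (hS : IsCommitteeSpace S)
    (hone : ‖S.monomial 1‖ = 1) (hv : IsRandomMultiplierModel S P v) (α : Γ) :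
    ‖⟪S.monomial α, rowOp S P v 1 (S.monomial α)⟫_ℂ‖ ≤
      ‖S.monomial α‖ ^ 2 * ‖colOp S P v 1‖ := by
  classical
  rw [hv.inner_rowOp_monomial hΓ hS]
  -- Left factors of distinct factorizations differ, so no `E|v_γ|²` is counted twice.
  have hinj : Set.InjOn (Prod.fst : Γ × Γ → Γ) (hΓ.finite_factorizations α).toFinset := by
    rintro ⟨a, b⟩ hp ⟨c, d⟩ hq (rfl : a = c)
    have hp' : a * b = α := by simpa using hp
    have hq' : a * d = α := by simpa using hq
    rw [hΓ.mul_left_cancel (hp'.trans hq'.symm)]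
  have hcol := hv.sum_norm_sq_le_norm_colOp hΓ hS hone
    ((hΓ.finite_factorizations α).toFinset.image Prod.fst)
  rw [Finset.sum_image hinj] at hcol
  refine le_trans ?_ (mul_le_mul_of_nonneg_left hcol (by positivity))
  rw [Finset.mul_sum]
  refine norm_sum_le_of_le _ fun p hp => ?_
  have hp' : p.1 * p.2 = α := by simpa using hp
  rw [Finset.sum_eq_single_of_mem p hp]
  · have hsq : ∫ ω, (starRingEnd ℂ) (v p.1 ω) * v p.1 ω ∂P =
        ((∫ ω, ‖v p.1 ω‖ ^ 2 ∂P : ℝ) : ℂ) := by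
      rw [← integral_complex_ofReal]
      simp [Complex.conj_mul']
    have hpos := S.norm_monomial_pos p.2
    have hI : 0 ≤ ∫ ω, ‖v p.1 ω‖ ^ 2 ∂P := integral_nonneg fun ω => by positivity
    -- The committee inequality enters here.
    have hle : ‖S.monomial α‖ ^ 2 ≤ (‖S.monomial p.1‖ * ‖S.monomial p.2‖) ^ 2 := by
      rw [← hp']
      gcongr
      exact hS.committee _ _
    rw [hsq, inner_self_eq_norm_sq_to_K]
    simp only [norm_mul, norm_div, norm_pow, Complex.norm_real, norm_norm, RCLike.norm_ofReal,
      abs_norm, Real.norm_of_nonneg hI]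
    have key : ‖S.monomial α‖ ^ 2 / ‖S.monomial p.2‖ ^ 2 *
        (‖S.monomial α‖ ^ 2 / ‖S.monomial p.2‖ ^ 2) * ‖S.monomial p.2‖ ^ 2 ≤
        ‖S.monomial α‖ ^ 2 * ‖S.monomial p.1‖ ^ 2 := by
      calc _ = ‖S.monomial α‖ ^ 2 * (‖S.monomial α‖ ^ 2 / ‖S.monomial p.2‖ ^ 2) := by
            field_simp
        _ ≤ _ := by
          refine mul_le_mul_of_nonneg_left ?_ (by positivity)
          rw [div_le_iff₀ (by positivity), ← mul_pow]
          exact hle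
    exact (mul_le_mul_of_nonneg_right key hI).trans_eq (by ring)
  · rintro ⟨c, d⟩ hq hne
    have hq' : c * d = α := by simpa using hq
    have h2 : p.2 ≠ d := by
      rintro rfl
      exact hne (Prod.ext (hΓ.mul_right_cancel (hq'.trans hp'.symm)) rfl)
    rw [hS.orthogonal _ _ h2, mul_zero, zero_mul]

lemma norm_rowOp_le_norm_colOp (hΓ : IsMonomialMonoid gen) (hS : IsCommitteeSpace S)
    (hone : ‖S.monomial 1‖ = 1) (hv : IsRandomMultiplierModel S P v) :
    ‖rowOp S P v 1‖ ≤ ‖colOp S P v 1‖ := by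
  refine hS.basis.norm_le_of_diagonal (norm_nonneg _) (fun α β h => ?_) fun α => ?_
  · simp [hS.basis_apply, hv.inner_rowOp_monomial_of_ne hΓ hS h]
  · have hpos := S.norm_monomial_pos α
    simp only [hS.basis_apply, map_smul, inner_smul_left, inner_smul_right, norm_mul, map_inv₀,
      Complex.conj_ofReal, norm_inv, Complex.norm_real, norm_norm]
    have := hv.norm_inner_rowOp_monomial_self_le hΓ hS hone α
    rw [← mul_assoc, ← mul_inv, ← sq, inv_mul_le_iff₀ (by positivity)]
    exact this

end IsRandomMultiplierModel

end RowColumnInequality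

/-! ### Evaluation at matrix tuples and the node projections. -/

section Evaluation

variable {ι Γ H : Type*} {gen : ι → Γ}

/-- The sum of the absolute values of the entries of a matrix. -/
def entrySum {N : ℕ} (A : Matrix (Fin N) (Fin N) ℂ) : ℝ := ∑ i, ∑ j, ‖A i j‖

lemma entrySum_pos {N : ℕ} {A : Matrix (Fin N) (Fin N) ℂ} (hA : A ≠ 0) : 0 < entrySum A := by
  obtain ⟨i, j, h⟩ : ∃ i j, A i j ≠ 0 := by
    by_contra! hcon
    exact hA (Matrix.ext hcon)
  exact Finset.sum_pos' (fun i _ => Finset.sum_nonneg fun j _ => norm_nonneg _)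
    ⟨i, Finset.mem_univ _, Finset.sum_pos' (fun j _ => norm_nonneg _)
      ⟨j, Finset.mem_univ _, norm_pos_iff.2 h⟩⟩

lemma measurable_sigma_of_mk {κ β : Type*} {X : κ → Type*} [∀ a, MeasurableSpace (X a)]
    [MeasurableSpace β] {f : Sigma X → β} (hf : ∀ a, Measurable fun y : X a => f ⟨a, y⟩) :
    Measurable f := by
  intro s hs
  exact MeasurableSpace.measurableSet_iInf.2 fun a => hf a hs

lemma MatrixTuple.measurable_entry_prod {N : ℕ} (l : List ι) (i j : Fin N) :
    Measurable fun y : ι → Fin N → Fin N → ℂ => (l.map fun a => Matrix.of (y a)).prod i j := by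
  induction l generalizing i with
  | nil => simp
  | cons a l ih =>
    simp only [List.map_cons, List.prod_cons, Matrix.mul_apply]
    refine Finset.measurable_fun_sum _ fun k _ => Measurable.mul ?_ (ih k)
    simp only [Matrix.of_apply]
    fun_prop

/-- Products along words make sense at every tuple and are polynomial in the entries, whereas
`evalMonomial` depends on a choice. -/
lemma MatrixTuple.measurable_entrySum_sum {κ : Type*} (s : Finset κ) (c : κ → ℂ)
    (w : κ → List ι) :
    Measurable fun x : MatrixTuple ι => entrySum (∑ γ ∈ s, c γ • ((w γ).map x.mat).prod) := by
  have hN : ∀ N : ℕ, Measurable fun y : ι → Fin N → Fin N → ℂ =>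
      entrySum (∑ γ ∈ s, c γ • ((w γ).map fun a => Matrix.of (y a)).prod) := by
    intro N
    simp only [entrySum, Matrix.sum_apply, Matrix.smul_apply, smul_eq_mul]
    exact Finset.measurable_fun_sum _ fun i _ => Finset.measurable_fun_sum _ fun j _ =>
      (Finset.measurable_fun_sum s fun γ _ =>
        (MatrixTuple.measurable_entry_prod (w γ) i j).const_mul (c γ)).norm
  exact measurable_sigma_of_mk (X := fun N : ℕ => ι → Fin N → Fin N → ℂ) hN

variable [Monoid Γ] [NormedAddCommGroup H] [InnerProductSpace ℂ H]
  {S : PowerSeriesSpace Γ H}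

lemma evalMonomial_word {x : MatrixTuple ι} (hx : ∃ φ, IsMonomialEval gen x φ) (l : List ι) :
    evalMonomial gen x (l.map gen).prod = (l.map x.mat).prod := by
  rw [evalMonomial, dif_pos hx, map_list_prod, List.map_map]
  congr 1
  exact List.map_congr_left fun i _ => hx.choose_spec i

namespace InNaturalDomain

lemma hasSum_entry {x : MatrixTuple ι} (hx : InNaturalDomain S gen x) (h : H)
    (i j : Fin x.1) :
    HasSum (fun γ => S.coeff h γ * evalMonomial gen x γ i j) (evalSeries S gen x h i j) :=
  Pi.hasSum.1 (Pi.hasSum.1 (hx.summable h).hasSum i) j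

variable [CompleteSpace H] [Countable Γ]

/-- Banach–Steinhaus: the partial sums are continuous functionals that converge pointwise. -/
lemma exists_entry_clm {x : MatrixTuple ι} (hx : InNaturalDomain S gen x) (i j : Fin x.1) :
    ∃ L : H →L[ℂ] ℂ, ∀ h, L h = evalSeries S gen x h i j := by
  let coeffL : Γ → H →L[ℂ] ℂ := fun γ =>
    ⟨(LinearMap.proj γ).comp S.coeff, S.continuous_coeff γ⟩
  let g : Finset Γ → H →L[ℂ] ℂ := fun s => ∑ γ ∈ s, evalMonomial gen x γ i j • coeffL γ
  refine ⟨continuousLinearMapOfTendsto (l := atTop) g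
    (f := fun h => evalSeries S gen x h i j) (tendsto_pi_nhds.2 fun h => ?_), fun h => rfl⟩
  have := hx.hasSum_entry h i j
  refine this.congr fun s => ?_
  simp only [g, coeffL, sum_apply, smul_apply,
    smul_eq_mul]
  exact Finset.sum_congr rfl fun γ _ => mul_comm _ _

lemma continuous_entrySum {x : MatrixTuple ι} (hx : InNaturalDomain S gen x) :
    Continuous fun h => entrySum (evalSeries S gen x h) := by
  refine continuous_finsetSum _ fun i _ => continuous_finsetSum _ fun j _ => Continuous.norm ?_
  obtain ⟨L, hL⟩ := hx.exists_entry_clm i j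
  exact L.continuous.congr hL

end InNaturalDomain

/-- Hence the span in `nodeProj` adds nothing, and taking the orthogonal complement twice returns
the vanishing space. -/
lemma exists_submodule_eq_vanishing [CompleteSpace H] [Countable Γ] {κ : Type*}
    {X : κ → MatrixTuple ι} (hX : ∀ k, InNaturalDomain S gen (X k)) :
    ∃ K : Submodule ℂ H, IsClosed (K : Set H) ∧
      (K : Set H) = {h | ∀ k, evalSeries S gen (X k) h = 0} := by
  choose L hL using fun k => (hX k).exists_entry_clm
  refine ⟨⨅ k, ⨅ i, ⨅ j, (L k i j).ker, ?_, ?_⟩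
  · simp only [Submodule.coe_iInf]
    exact isClosed_iInter fun k => isClosed_iInter fun i => isClosed_iInter fun j =>
      (L k i j).isClosed_ker
  · ext h
    simp [hL, ← Matrix.ext_iff]

variable [CompleteSpace H]

lemma isStarProjection_nodeProj {n : ℕ} (X : Fin n → MatrixTuple ι) :
    IsStarProjection (nodeProj S gen X) :=
  isStarProjection_starProjection

/-- The projections `P_{X_n}` increase to the identity if no nonzero element vanishes on all
nodes. -/
lemma tendsto_nodeProj [Countable Γ] {X : ℕ → MatrixTuple ι}
    (hX : ∀ k, InNaturalDomain S gen (X k))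
    (huniq : ∀ h : H, (∀ k, evalSeries S gen (X k) h = 0) → h = 0) (h : H) :
    Tendsto (fun n : ℕ => nodeProj S gen (fun k : Fin n => X k) h) atTop (𝓝 h) := by
  choose K hKc hK using fun n : ℕ =>
    exists_submodule_eq_vanishing (S := S) (gen := gen) (X := fun k : Fin n => X k) fun k => hX k
  have hmem : ∀ n h, h ∈ K n ↔ ∀ k : Fin n, evalSeries S gen (X k) h = 0 := fun n h =>
    Set.ext_iff.1 (hK n) h
  have hproj : ∀ n, nodeProj S gen (fun k : Fin n => X k) = (K n)ᗮ.starProjection := by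
    intro n
    rw [nodeProj]
    congr! 2
    rw [← hK, Submodule.span_eq]
  simp only [hproj]
  refine Submodule.starProjection_tendsto_self (fun n => (K n)ᗮ) (fun m n hmn => ?_) h ?_
  · refine Submodule.orthogonal_le fun f hf => ?_
    rw [hmem] at hf ⊢
    exact fun k => hf (Fin.castLE hmn k)
  -- The increasing spaces `(K n)ᗮ` have dense span because the intersection of the `K n` is zero.
  · rw [top_le_iff, Submodule.topologicalClosure_eq_top_iff, ← Submodule.iInf_orthogonal,
      Submodule.eq_bot_iff]
    intro f hf
    simp only [Submodule.mem_iInf, Submodule.orthogonal_orthogonal_eq_closure,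
      (hKc _).submodule_topologicalClosure_eq, hmem] at hf
    exact huniq f fun k => hf (k + 1) ⟨k, k.lt_succ_self⟩

end Evaluation

/-! ### Uniqueness on a random sample. -/

section RandomPoints

variable {ι Γ H Ω : Type*} [Monoid Γ] [Countable Γ] {gen : ι → Γ} [NormedAddCommGroup H]
  [InnerProductSpace ℂ H] [CompleteSpace H] {S : PowerSeriesSpace Γ H} [MeasurableSpace Ω]
  {P : Measure Ω}

/-- Around a nonzero element there is a ball none of whose elements vanishes on a certain set of
points of positive probability. -/
lemma IsRandomPoint.exists_ball_ne_zero [IsProbabilityMeasure P] (hΓ : IsMonomialMonoid gen)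
    {x : Ω → MatrixTuple ι}
    (hx : IsRandomPoint S gen P x) {h₀ : H} (h0 : h₀ ≠ 0) :
    ∃ r > 0, ∃ E : Set (MatrixTuple ι), MeasurableSet E ∧ P (x ⁻¹' E) ≠ 0 ∧
      ∀ y ∈ E, InNaturalDomain S gen y → ∀ h ∈ Metric.ball h₀ r, evalSeries S gen y h ≠ 0 := by
  have := S.separableSpace
  have : SecondCountableTopology H := UniformSpace.secondCountable_of_separable H
  obtain ⟨D, hDs, hDc, hD⟩ := S.dense_polynomials.exists_countable_dense_subset
  choose w hw using hΓ.exists_word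
  have hfin : ∀ p ∈ D, ∃ s : Finset Γ, ∀ γ ∉ s, S.coeff p γ = 0 := fun p hp =>
    ⟨(S.finite_support_coeff (hDs hp)).toFinset, fun γ hγ => by simpa using hγ⟩
  choose! s hs using hfin
  have heval : ∀ p ∈ D, ∀ y, InNaturalDomain S gen y → evalSeries S gen y p =
      ∑ γ ∈ s p, S.coeff p γ • ((w γ).map y.mat).prod := by
    intro p hp y hy
    rw [evalSeries, tsum_eq_sum (s := s p)]
    · refine Finset.sum_congr rfl fun γ _ => ?_
      rw [← evalMonomial_word hy.homomorphism, hw]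
    · intro γ hγ
      rw [hs p hp γ hγ, zero_smul]
  -- Polynomials from a countable dense set near `h₀` stay away from zero at `y`. Countability makes
  -- the condition measurable, density extends it to the ball.
  let E : ℕ → Set (MatrixTuple ι) := fun n => ⋂ p ∈ D,
    ⋂ (_ : dist p h₀ < 1 / (n + 1 : ℝ)), {y | 1 / (n + 1 : ℝ) ≤
      entrySum (∑ γ ∈ s p, S.coeff p γ • ((w γ).map y.mat).prod)}
  have hE : ∀ n, MeasurableSet (E n) := fun n =>
    MeasurableSet.biInter hDc fun p hp => MeasurableSet.iInter fun _ =>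
      measurableSet_le measurable_const (MatrixTuple.measurable_entrySum_sum _ _ _)
  have hEmem : ∀ n y, InNaturalDomain S gen y → (y ∈ E n ↔ ∀ p ∈ D, dist p h₀ < 1 / (n + 1 : ℝ) →
      1 / (n + 1 : ℝ) ≤ entrySum (evalSeries S gen y p)) := by
    intro n y hy
    simp only [E, Set.mem_iInter, Set.mem_ofPred_eq]
    exact forall₂_congr fun p hp => by rw [heval p hp y hy]
  -- If `h₀(y) ≠ 0`, continuity of evaluation puts `y` in some `E n`; were all of them null, `h₀`
  -- would vanish almost surely.
  obtain ⟨n, hn⟩ : ∃ n, P (x ⁻¹' E n) ≠ 0 := by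
    by_contra! hcon
    have hae : ∀ᵐ ω ∂P, evalSeries S gen (x ω) h₀ = 0 := by
      have hnot : ∀ᵐ ω ∂P, ∀ n, x ω ∉ E n :=
        ae_all_iff.2 fun n => measure_eq_zero_iff_ae_notMem.1 (hcon n)
      filter_upwards [hx.inNaturalDomain, hnot] with ω hω hnot
      by_contra hne
      have hpos := entrySum_pos hne
      obtain ⟨r, hr, hball⟩ := Metric.eventually_nhds_iff.1
        (hω.continuous_entrySum.continuousAt.eventually_const_lt (half_lt_self hpos))
      obtain ⟨n, hn⟩ := exists_nat_one_div_lt (lt_min hr (half_pos hpos))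
      refine hnot n ((hEmem n _ hω).2 fun p _ hp => ?_)
      exact (hn.le.trans (min_le_right _ _)).trans
        (hball (hp.trans (hn.trans_le (min_le_left _ _)))).le
    refine (hx.prob_lt_one h₀ h0).ne ?_
    exact (measure_congr (eventuallyEq_univ.2 hae)).trans measure_univ
  refine ⟨1 / (n + 1), by positivity, E n, hE n, hn, fun y hyE hy h hh hzero => ?_⟩
  -- A zero `h` in the ball would have a polynomial of `D` nearby, still in the ball, with too small
  -- a value at `y`.
  have hopen : IsOpen ({f | entrySum (evalSeries S gen y f) < 1 / (n + 1 : ℝ)} ∩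
      Metric.ball h₀ (1 / (n + 1))) :=
    (isOpen_lt hy.continuous_entrySum continuous_const).inter Metric.isOpen_ball
  obtain ⟨p, ⟨hp1, hp2⟩, hpD⟩ := hD.inter_open_nonempty _ hopen
    ⟨h, by simp only [Set.mem_ofPred_eq, hzero, entrySum]; simp; positivity, hh⟩
  exact (not_le.2 hp1) ((hEmem n y hy).1 hyE p hpD hp2)

/-- The first `n` samples all miss `E` with probability `q ^ n`, where `q < 1`. -/
lemma ae_exists_mem_of_iIndepFun {β : Type*} [MeasurableSpace β] [IsProbabilityMeasure P]
    {x : ℕ → Ω → β} (hx : AEMeasurable (x 0) P) (hindep : iIndepFun x P)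
    (hident : ∀ k, IdentDistrib (x k) (x 0) P P) {E : Set β} (hE : MeasurableSet E)
    (hpos : P (x 0 ⁻¹' E) ≠ 0) : ∀ᵐ ω ∂P, ∃ k, x k ω ∈ E := by
  have hlt : P (x 0 ⁻¹' Eᶜ) < 1 := by
    rw [Set.preimage_compl, prob_compl_eq_one_sub₀ (hx.nullMeasurableSet_preimage hE)]
    exact ENNReal.sub_lt_self ENNReal.one_ne_top one_ne_zero hpos
  have hle : ∀ n : ℕ, P {ω | ¬∃ k, x k ω ∈ E} ≤ P (x 0 ⁻¹' Eᶜ) ^ n := by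
    intro n
    calc P {ω | ¬∃ k, x k ω ∈ E} ≤ P (⋂ k ∈ Finset.range n, x k ⁻¹' Eᶜ) := by
          refine measure_mono fun ω hω => ?_
          simp only [Set.mem_iInter]
          exact fun k _ hk => hω ⟨k, hk⟩
      _ = P (x 0 ⁻¹' Eᶜ) ^ n := by
          rw [hindep.measure_inter_preimage_eq_mul (Finset.range n) fun _ _ => hE.compl]
          rw [Finset.prod_congr rfl fun k _ => (hident k).measure_mem_eq hE.compl,
            Finset.prod_const, Finset.card_range]
  exact le_antisymm (ge_of_tendsto' (ENNReal.tendsto_pow_atTop_nhds_zero_of_lt_one hlt) hle)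
    zero_le

/-- Almost surely, no nonzero element vanishes at all points of an independent sample. -/
lemma ae_eq_zero_of_vanishing [IsProbabilityMeasure P] (hΓ : IsMonomialMonoid gen)
    {x : ℕ → Ω → MatrixTuple ι} (hx : ∀ k, IsRandomPoint S gen P (x k)) (hindep : iIndepFun x P)
    (hident : ∀ k, IdentDistrib (x k) (x 0) P P) :
    ∀ᵐ ω ∂P, ∀ h : H, (∀ k, evalSeries S gen (x k ω) h = 0) → h = 0 := by
  have := S.separableSpace
  have : SecondCountableTopology H := UniformSpace.secondCountable_of_separable H
  choose! r hr E hE hpos hne using fun (h₀ : H) (h0 : h₀ ≠ 0) =>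
    (hx 0).exists_ball_ne_zero hΓ h0
  -- By the Lindelöf property countably many balls suffice, so the exceptional null sets can be
  -- united.
  obtain ⟨t, ht, htc, hcover⟩ := TopologicalSpace.countable_cover_nhdsWithin
    (f := fun h₀ => Metric.ball h₀ (r h₀)) (s := {h : H | h ≠ 0})
    fun h₀ h0 => mem_nhdsWithin_of_mem_nhds (Metric.ball_mem_nhds _ (hr h₀ h0))
  have hhit : ∀ᵐ ω ∂P, ∀ h₀ ∈ t, ∃ k, x k ω ∈ E h₀ :=
    (ae_ball_iff htc).2 fun h₀ h0 => ae_exists_mem_of_iIndepFun (hx 0).aemeasurable hindep hident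
      (hE h₀ (ht h0)) (hpos h₀ (ht h0))
  filter_upwards [hhit, ae_all_iff.2 fun k => (hx k).inNaturalDomain] with ω hω hdom h hzero
  by_contra h0
  obtain ⟨h₀, hh₀, hball⟩ := Set.mem_iUnion₂.1 (hcover h0)
  obtain ⟨k, hk⟩ := hω h₀ hh₀
  exact hne h₀ (ht hh₀) _ hk (hdom k) h hball (hzero k)

end RandomPoints

end

theorem corollary2 {ι Γ H Ω Ω' : Type*} [Countable ι] [Monoid Γ] (gen : ι → Γ)
    (hΓ : IsMonomialMonoid gen)
    [NormedAddCommGroup H] [InnerProductSpace ℂ H] [CompleteSpace H]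
    (S : PowerSeriesSpace Γ H) (hS : IsCommitteeSpace S) (hone : ‖S.monomial 1‖ = 1)
    [MeasurableSpace Ω] (P : Measure Ω) [IsProbabilityMeasure P]
    (v : Γ → Ω → ℂ) (hv : IsRandomMultiplierModel S P v)
    [MeasurableSpace Ω'] (P' : Measure Ω') [IsProbabilityMeasure P']
    (x : ℕ → Ω' → MatrixTuple ι) (hx : ∀ k, IsRandomPoint S gen P' (x k))
    (hindep : iIndepFun x P') (hident : ∀ k, IdentDistrib (x k) (x 0) P' P') :
    HasOperatorExpectation P (rowTerm S v 1) (rowOp S P v 1) ∧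
    HasOperatorExpectation P (colTerm S v 1) (colOp S P v 1) ∧
    ∀ᵐ ω ∂P',
      (∀ n : ℕ,
        HasOperatorExpectation P (rowTerm S v (nodeProj S gen fun k : Fin n => x k ω))
          (rowOp S P v (nodeProj S gen fun k : Fin n => x k ω)) ∧
        HasOperatorExpectation P (colTerm S v (nodeProj S gen fun k : Fin n => x k ω))
          (colOp S P v (nodeProj S gen fun k : Fin n => x k ω))) ∧
      Tendsto (fun n : ℕ => ‖rowOp S P v (nodeProj S gen fun k : Fin n => x k ω)‖) atTop
        (𝓝 ‖rowOp S P v 1‖) ∧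
      Tendsto (fun n : ℕ => ‖colOp S P v (nodeProj S gen fun k : Fin n => x k ω)‖) atTop
        (𝓝 ‖colOp S P v 1‖) ∧
      ‖rowOp S P v 1‖ ≤ ‖colOp S P v 1‖ := by
  have := hΓ.countable
  refine ⟨hv.hasOperatorExpectation_rowOp hΓ hS (.one _),
    hv.hasOperatorExpectation_colOp hΓ hS (.one _), ?_⟩
  filter_upwards [ae_all_iff.2 fun k => (hx k).inNaturalDomain,
    ae_eq_zero_of_vanishing hΓ hx hindep hident] with ω hdom huniq
  have hlim := tendsto_nodeProj hdom huniq
  exact ⟨fun n => ⟨hv.hasOperatorExpectation_rowOp hΓ hS (isStarProjection_nodeProj _),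
      hv.hasOperatorExpectation_colOp hΓ hS (isStarProjection_nodeProj _)⟩,
    hv.tendsto_norm_rowOp hΓ hS (fun _ => isStarProjection_nodeProj _) hlim,
    hv.tendsto_norm_colOp hΓ hS (fun _ => isStarProjection_nodeProj _) hlim,
    hv.norm_rowOp_le_norm_colOp hΓ hS hone⟩
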